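/- Let $G$ be a finite simple graph with $n$ vertices and at least one edge. Let $L=D-A$ be its Laplacian matrix, where $D$ is the diagonal matrix of vertex degrees and $A$ is the adjacency matrix, and let $\mu_1\le\mu_2\le\dots\le\mu_n$ be the eigenvalues of $L$, counted with multiplicity. Let $k$ be a positive integer such that $n\ge k+1$ and $kn$ is even. If $$\frac{\mu_2}{\mu_n}\ \ge\ \frac{k}{k+1},$$ then $G$ has a $k$-factor, that is, a spanning subgraph $H$ of $G$ in which every vertex has degree exactly $k$. -/

import Mathlib

namespace SimpleGraph

/-- The `i`-th smallest eigenvalue `μ_i` (`1 ≤ i ≤ n`, counted with multiplicity) of the Laplacian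
matrix `L = D - A` of a graph on `n` vertices; the value outside this range of `i` is `0`.
Mathlib's `eigenvalues₀` lists the eigenvalues in decreasing order, starting at index `0`, so that
`μ_i` is the entry at index `n - i`. -/
noncomputable def laplacianEigenvalue {V : Type*} [Fintype V] [DecidableEq V]
    (G : SimpleGraph V) [DecidableRel G.Adj] (i : ℕ) : ℝ :=
  if h : 1 ≤ i ∧ i ≤ Fintype.card V then
    (G.isHermitian_lapMatrix ℝ).eigenvalues₀ ⟨Fintype.card V - i, by omega⟩
  else 0

open Classical in
/-- A graph has a `k`-factor if it has a spanning subgraph `H` in which every vertex has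
degree `k`. -/
def HasFactor {V : Type*} [Fintype V] (G : SimpleGraph V) (k : ℕ) : Prop :=
  ∃ H : SimpleGraph V, H ≤ G ∧ H.IsRegularOfDegree k

end SimpleGraph

/-! ### Spectral expansion of Hermitian quadratic forms -/

section

open Finset Matrix

/-! The factor is assembled from matchings. Let `2k ≤ n` with `n` even, and let `F ≤ G` be regular
of degree below `k`. A perfect matching of `G \ F` raises the degree by one. If there is none,
Tutte's theorem and parity give a set `S` whose removal leaves at least `|S| + 2` components of `G \
F`, and every edge of `G` between two of these parts lies in `F`. A part of size `a` sends out at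
least `μ₂ a (n - a) / n` edges, while at most `μₙ |S| (n - |S|) / n` edges join `S` to its
complement, and `F` contributes at most `k - 1` per vertex. These estimates conflict
(`LaplacianBounds.false_of_partition`).

For `k ≥ 2` the contribution of `F` is absorbed only if `μ₂` is large. The inequality for separated
sets (`LaplacianBounds.separated`) makes all degrees large; a bad partition forces a vertex of
degree about `n / 2 + k` at most. Together they give `n ≥ 4k² + 3` and then `μ₂ ≥ 7(k - 1)`.

If `n` is odd, then `k` is even and the degree grows by two: an edge `uv` is added, then two
matchings missing only `u` and only `v`. If `n < 2k`, then `G` is complete and the complement of an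
`(n - 1 - k)`-factor is taken. -/

/-- The quadratic form of a real Hermitian matrix in terms of its eigenvalues. -/
theorem Matrix.IsHermitian.dotProduct_mulVec_eq_sum {V : Type*} [Fintype V] [DecidableEq V]
    {A : Matrix V V ℝ} (hA : A.IsHermitian) (x : V → ℝ) :
    x ⬝ᵥ (A *ᵥ x) = ∑ j, hA.eigenvalues j * (⇑(hA.eigenvectorBasis j) ⬝ᵥ x) ^ 2 := by
  set b := hA.eigenvectorBasis
  have hsym : ∀ j, (⇑(b j) : V → ℝ) ⬝ᵥ (A *ᵥ x) = hA.eigenvalues j * (⇑(b j) ⬝ᵥ x) := by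
    intro j
    have ht : Aᵀ = A := by simpa [conjTranspose_eq_transpose_of_trivial] using hA.eq
    rw [dotProduct_mulVec, ← mulVec_transpose, ht, hA.mulVec_eigenvectorBasis, smul_dotProduct,
      smul_eq_mul]
  have h := b.sum_inner_mul_inner (WithLp.toLp 2 x) (WithLp.toLp 2 (A *ᵥ x))
  have h1 : ∀ u v : EuclideanSpace ℝ V, inner ℝ u v = (⇑u : V → ℝ) ⬝ᵥ ⇑v := by
    intro u v
    simp [PiLp.inner_apply, dotProduct, mul_comm]
  simp only [h1] at h
  rw [← h]
  refine sum_congr rfl fun j _ => ?_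
  change (x ⬝ᵥ ⇑(b j)) * (⇑(b j) ⬝ᵥ (A *ᵥ x)) = _
  rw [hsym, dotProduct_comm]
  ring

/-- Parseval's identity for the eigenvector basis of a real Hermitian matrix. -/
theorem Matrix.IsHermitian.dotProduct_self_eq_sum {V : Type*} [Fintype V] [DecidableEq V]
    {A : Matrix V V ℝ} (hA : A.IsHermitian) (x : V → ℝ) :
    x ⬝ᵥ x = ∑ j, (⇑(hA.eigenvectorBasis j) ⬝ᵥ x) ^ 2 := by
  have h := hA.eigenvectorBasis.sum_inner_mul_inner (WithLp.toLp 2 x) (WithLp.toLp 2 x)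
  have h1 : ∀ u v : EuclideanSpace ℝ V, inner ℝ u v = (⇑u : V → ℝ) ⬝ᵥ ⇑v := by
    intro u v
    simp [PiLp.inner_apply, dotProduct, mul_comm]
  simp only [h1] at h
  change _ = x ⬝ᵥ x at h
  rw [← h]
  refine sum_congr rfl fun j _ => ?_
  change (x ⬝ᵥ _) * (_ ⬝ᵥ x) = _
  rw [dotProduct_comm x]
  ring

/-! ### From Laplacian eigenvalues to bounds on the energy -/

namespace SimpleGraph

variable {V : Type*} [Fintype V] [DecidableEq V] (G : SimpleGraph V) [DecidableRel G.Adj]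

/-- The Laplacian quadratic form `∑_{uv ∈ E} (x u - x v) ^ 2`. -/
noncomputable def energy (x : V → ℝ) : ℝ :=
  (∑ i, ∑ j, if G.Adj i j then (x i - x j) ^ 2 else 0) / 2

/-- The nontrivial eigenvalues of the Laplacian lie in `[m, M]`, stated for the quadratic forms
`energy` and `n ∑ x² - (∑ x)²` (`n` times the squared length of the projection of `x` to `1ᗮ`). -/
def LaplacianBounds (m M : ℝ) : Prop :=
  ∀ x : V → ℝ,
    m * (Fintype.card V * ∑ i, x i ^ 2 - (∑ i, x i) ^ 2) ≤ Fintype.card V * G.energy x ∧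
    Fintype.card V * G.energy x ≤ M * (Fintype.card V * ∑ i, x i ^ 2 - (∑ i, x i) ^ 2)

theorem dotProduct_lapMatrix_mulVec (x : V → ℝ) :
    x ⬝ᵥ (G.lapMatrix ℝ *ᵥ x) = G.energy x := by
  rw [← toLinearMap₂'_apply', lapMatrix_toLinearMap₂', energy]

theorem eigenvalues_lapMatrix_nonneg (i : V) :
    0 ≤ (G.isHermitian_lapMatrix ℝ).eigenvalues i :=
  (G.posSemidef_lapMatrix (R := ℝ)).eigenvalues_nonneg i

theorem eigenvalues_le_laplacianEigenvalue_card (i : V) :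
    (G.isHermitian_lapMatrix ℝ).eigenvalues i ≤ G.laplacianEigenvalue (Fintype.card V) := by
  have hV : 1 ≤ Fintype.card V := Fintype.card_pos_iff.mpr ⟨i⟩
  rw [laplacianEigenvalue, dif_pos ⟨hV, le_rfl⟩, IsHermitian.eigenvalues]
  apply IsHermitian.eigenvalues₀_antitone
  simp [Fin.le_def]

/-- All eigenvalues but the last one in Mathlib's list are at least the second smallest one. -/
theorem exists_forall_ne_laplacianEigenvalue_two_le (hV : 2 ≤ Fintype.card V) :
    ∃ i₀ : V, ∀ i ≠ i₀,
      G.laplacianEigenvalue 2 ≤ (G.isHermitian_lapMatrix ℝ).eigenvalues i := by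
  set e : Fin (Fintype.card V) ≃ V := Fintype.equivOfCardEq (Fintype.card_fin _) with he
  refine ⟨e ⟨Fintype.card V - 1, by omega⟩, fun i hi => ?_⟩
  rw [laplacianEigenvalue, dif_pos ⟨by omega, hV⟩, IsHermitian.eigenvalues]
  apply IsHermitian.eigenvalues₀_antitone
  rw [Fin.le_def]
  have h1 : e.symm i ≠ ⟨Fintype.card V - 1, by omega⟩ := by
    intro h
    exact hi (by rw [← h, Equiv.apply_symm_apply])
  have h2 := (e.symm i).isLt
  have h3 : (e.symm i : ℕ) ≠ Fintype.card V - 1 := fun h => h1 (Fin.ext h)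
  change (e.symm i : ℕ) ≤ Fintype.card V - 2
  omega

theorem laplacianEigenvalue_nonneg (i : ℕ) : 0 ≤ G.laplacianEigenvalue i := by
  rw [laplacianEigenvalue]
  split_ifs with h
  · set e : Fin (Fintype.card V) ≃ V := Fintype.equivOfCardEq (Fintype.card_fin _) with he
    have := G.eigenvalues_lapMatrix_nonneg (e ⟨Fintype.card V - i, by omega⟩)
    rw [IsHermitian.eigenvalues, ← he, Equiv.symm_apply_apply] at this
    exact this
  · exact le_rfl

theorem laplacianBounds_laplacianEigenvalue (hV : 2 ≤ Fintype.card V)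
    (hpos : 0 < G.laplacianEigenvalue 2) :
    G.LaplacianBounds (G.laplacianEigenvalue 2) (G.laplacianEigenvalue (Fintype.card V)) := by
  set m := G.laplacianEigenvalue 2
  set M := G.laplacianEigenvalue (Fintype.card V)
  set hA := G.isHermitian_lapMatrix ℝ
  obtain ⟨i₀, hi₀⟩ := G.exists_forall_ne_laplacianEigenvalue_two_le hV
  -- Since `L 1 = 0`, the expansion of `1ᵀ L 1` is a vanishing sum of nonnegative terms, and every
  -- eigenvalue off `i₀` is positive.
  have hone : ∀ i ≠ i₀, (⇑(hA.eigenvectorBasis i) : V → ℝ) ⬝ᵥ (fun _ => 1) = 0 := by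
    have h0 : (fun _ => (1 : ℝ)) ⬝ᵥ (G.lapMatrix ℝ *ᵥ fun _ => 1) = 0 := by
      rw [lapMatrix_mulVec_const_eq_zero, dotProduct_zero]
    rw [hA.dotProduct_mulVec_eq_sum, sum_eq_zero_iff_of_nonneg
      fun i _ => mul_nonneg (G.eigenvalues_lapMatrix_nonneg i) (sq_nonneg _)] at h0
    intro i hi
    have := h0 i (mem_univ i)
    have hne : hA.eigenvalues i ≠ 0 := (hpos.trans_le (hi₀ i hi)).ne'
    simpa [hne] using this
  have hcent : ∀ y : V → ℝ, ∑ i, y i = 0 → m * (y ⬝ᵥ y) ≤ G.energy y ∧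
      G.energy y ≤ M * (y ⬝ᵥ y) := by
    intro y hy
    -- The vector `1` is a nonzero multiple of the `i₀`-th eigenvector, so `y ⟂ 1` removes that
    -- coordinate.
    have hy0 : ⇑(hA.eigenvectorBasis i₀) ⬝ᵥ y = 0 := by
      have h := hA.eigenvectorBasis.sum_inner_mul_inner (WithLp.toLp 2 (fun _ => (1 : ℝ)))
        (WithLp.toLp 2 y)
      have h' := hA.dotProduct_self_eq_sum (fun _ => 1)
      have h1 : ∀ u v : EuclideanSpace ℝ V, inner ℝ u v = (⇑u : V → ℝ) ⬝ᵥ ⇑v := by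
        intro u v
        simp [PiLp.inner_apply, dotProduct, mul_comm]
      simp only [h1] at h
      change ∑ i, ((fun _ => (1 : ℝ)) ⬝ᵥ ⇑(hA.eigenvectorBasis i)) * (_ ⬝ᵥ y) =
        (fun _ => (1 : ℝ)) ⬝ᵥ y at h
      rw [sum_eq_single i₀ (fun i _ hi => by rw [dotProduct_comm, hone i hi, zero_mul])
        (by simp)] at h
      rw [sum_eq_single i₀ (fun i _ hi => by rw [hone i hi]; simp) (by simp)] at h'
      have hr : (fun _ => (1 : ℝ)) ⬝ᵥ y = 0 := by simpa [dotProduct] using hy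
      rw [hr] at h
      rcases mul_eq_zero.mp h with h2 | h2
      · exfalso
        rw [dotProduct_comm] at h2
        rw [h2] at h'
        simp [dotProduct] at h'
        omega
      · exact h2
    rw [← dotProduct_lapMatrix_mulVec, hA.dotProduct_mulVec_eq_sum, hA.dotProduct_self_eq_sum,
      mul_sum, mul_sum]
    constructor
    · refine sum_le_sum fun i _ => ?_
      by_cases hi : i = i₀
      · rw [hi, hy0]; simp
      · exact mul_le_mul_of_nonneg_right (hi₀ i hi) (sq_nonneg _)
    · exact sum_le_sum fun i _ =>
        mul_le_mul_of_nonneg_right (G.eigenvalues_le_laplacianEigenvalue_card i) (sq_nonneg _)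
  intro x
  have hn : (0 : ℝ) < Fintype.card V := by
    have : 0 < Fintype.card V := by omega
    exact_mod_cast this
  set n : ℝ := (Fintype.card V : ℝ) with hndef
  set s := ∑ i, x i
  -- Centring `n x` instead of `x` avoids dividing by `n`.
  obtain ⟨h1, h2⟩ := hcent (fun i => n * x i - s) (by
    rw [sum_sub_distrib, ← mul_sum]; simp [hndef, s])
  have hE : G.energy (fun i => n * x i - s) = n ^ 2 * G.energy x := by
    simp only [energy]
    rw [← mul_div_assoc, mul_sum]
    congr 1
    refine sum_congr rfl fun i _ => ?_
    rw [mul_sum]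
    refine sum_congr rfl fun j _ => ?_
    split_ifs <;> ring
  have hN : (fun i => n * x i - s) ⬝ᵥ (fun i => n * x i - s) =
      n * (n * ∑ i, x i ^ 2 - s ^ 2) := by
    have : ∀ i, (n * x i - s) * (n * x i - s) = n ^ 2 * x i ^ 2 - 2 * n * s * x i + s ^ 2 := by
      intro i; ring
    simp only [dotProduct, this]
    rw [sum_add_distrib, sum_sub_distrib, ← mul_sum, ← mul_sum]
    simp only [sum_const, card_univ, nsmul_eq_mul, ← hndef]
    ring
  rw [hE, hN] at h1 h2
  constructor
  · refine le_of_mul_le_mul_left ?_ hn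
    linarith
  · refine le_of_mul_le_mul_left ?_ hn
    linarith

end SimpleGraph

/-! ### Numerical inequalities -/

/-- Inserting the largest `d` allowed by `hd` leaves a convex quadratic in `n` that must be
nonnegative. It is negative at `2k + 2` and at `4k² + 2`, hence on the whole interval between them.
-/
theorem four_mul_sq_add_three_le_of_degree_bounds {n d k : ℝ} (hn : 2 * k + 2 ≤ n) (hk : 0 ≤ k)
    (hd : 2 * d + 3 ≤ n + 2 * k) (h : (2 * k + 1) ^ 2 * (n - 1 - d) ≤ (n - 1) * (d + 1)) :
    4 * k ^ 2 + 2 < n := by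
  by_contra! hcon
  have h1 : 0 ≤ (n + 2 * k - 3 - 2 * d) * ((2 * k + 1) ^ 2 + (n - 1)) :=
    mul_nonneg (by linarith) (by nlinarith [sq_nonneg (2 * k + 1)])
  have h2 : 0 ≤ (n - 2 * k - 2) * (4 * k ^ 2 + 2 - n) :=
    mul_nonneg (by linarith) (by linarith)
  nlinarith

/-- Eliminating `d` and `M` gives `m ≥ 4k²n / ((2k + 1)² + n - 1)`, which increases with `n`. The
constant 7 is dictated by `k = 2`, `n = 19`, where this bound is `304 / 43`. -/
theorem seven_mul_le_of_degree_bounds {n d m M : ℝ} {k : ℕ} (hk : 2 ≤ k)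
    (hn : 4 * (k : ℝ) ^ 2 + 3 ≤ n)
    (h : (2 * (k : ℝ) + 1) ^ 2 * (n - 1 - d) ≤ (n - 1) * (d + 1))
    (hM : n * d ≤ M * (n - 1)) (hm : k * M ≤ (k + 1) * m) :
    7 * ((k : ℝ) - 1) ≤ m := by
  have hk' : (2 : ℝ) ≤ k := by exact_mod_cast hk
  have hn1 : 0 < n - 1 := by nlinarith
  have h1 : n * (4 * k * (k + 1)) ≤ M * ((2 * (k : ℝ) + 1) ^ 2 + n - 1) := by
    refine le_of_mul_le_mul_right ?_ hn1
    have hK : 0 ≤ (2 * (k : ℝ) + 1) ^ 2 + n - 1 := by nlinarith [sq_nonneg (2 * (k : ℝ) + 1)]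
    have h2 := mul_le_mul_of_nonneg_right hM hK
    have h3 := mul_le_mul_of_nonneg_left h (by linarith : 0 ≤ n)
    nlinarith
  have h2 : 4 * (k : ℝ) ^ 2 * n ≤ m * ((2 * (k : ℝ) + 1) ^ 2 + n - 1) := by
    have hK : 0 ≤ (2 * (k : ℝ) + 1) ^ 2 + n - 1 := by nlinarith [sq_nonneg (2 * (k : ℝ) + 1)]
    have h3 := mul_le_mul_of_nonneg_right hm hK
    have h4 := mul_le_mul_of_nonneg_left h1 (by linarith : (0 : ℝ) ≤ k)
    refine le_of_mul_le_mul_left ?_ (by linarith : (0 : ℝ) < k + 1)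
    linarith
  by_contra! hcon
  have hK : 0 < (2 * (k : ℝ) + 1) ^ 2 + n - 1 := by nlinarith [sq_nonneg (2 * (k : ℝ) + 1)]
  have h3 := mul_lt_mul_of_pos_right hcon hK
  have h4 : n * (4 * (k : ℝ) ^ 2 - 7 * k + 7) < 28 * (k - 1) * k * (k + 1) := by nlinarith
  have h5 : 0 ≤ (n - (4 * (k : ℝ) ^ 2 + 3)) * (4 * (k : ℝ) ^ 2 - 7 * k + 7) :=
    mul_nonneg (by linarith) (by nlinarith)
  rcases hk.eq_or_lt with rfl | hk3
  · norm_num at h4 h5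
    linarith
  · have hk3' : (3 : ℝ) ≤ k := by exact_mod_cast hk3
    have h6 : 0 ≤ (k : ℝ) ^ 2 * ((2 * k - 5) * (k - 1)) :=
      mul_nonneg (sq_nonneg _) (mul_nonneg (by linarith) (by linarith))
    nlinarith

/-- In the three cut lemmas `s = |S|`, `a` is the size of the largest part, and `p`, `x`, `Q` are
the number, total size and sum of squared sizes of the other parts. For `k = 1`, cancelling `m`
leaves `(a + x)(a + x - s) ≤ a² + Q`, which the spare part in `s + 1 ≤ p` rules out. -/
theorem cut_inequality_false_of_one {n s a x p Q m M : ℝ} (hn : n = s + a + x) (hm : 0 < m)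
    (hM : M ≤ 2 * m) (hs : 0 ≤ s) (ha : 1 ≤ a) (hpx : p ≤ x) (hx : 0 ≤ x) (hsp : s + 1 ≤ p)
    (hQ : Q + a * p ≤ x + a * x)
    (h : m * ((a + x) * n - a ^ 2 - Q) ≤ M * (s * (a + x))) : False := by
  have h1 : m * ((a + x) * n - a ^ 2 - Q) ≤ m * (2 * (s * (a + x))) := by
    have := mul_le_mul_of_nonneg_right hM (by positivity : 0 ≤ s * (a + x))
    linarith
  have h2 := le_of_mul_le_mul_left h1 hm
  subst hn
  have h3 : 0 ≤ (x - p) * x := mul_nonneg (by linarith) hx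
  have h4 : 0 ≤ (p - (s + 1)) * (a + x) := mul_nonneg (by linarith) (by linarith)
  nlinarith

/-- One part dominates: `n ≤ 3a`, and the pairs counted by `g` are charged to endpoints outside that
part. This yields `m ≤ 3k`, against `m ≥ 7(k - 1)`. -/
theorem cut_inequality_false_of_le {n s a x p Q g k m M : ℝ} (hn : n = s + a + x)
    (hk : 2 ≤ k) (hm : 7 * (k - 1) ≤ m) (hM : k * M ≤ (k + 1) * m)
    (hs : 0 ≤ s) (hxa : x ≤ a) (hpx : p ≤ x) (hsp : s ≤ p) (hp : 1 ≤ p)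
    (hQ : Q + (x - p + 1) * p ≤ x + (x - p + 1) * x) (hg : g ≤ 2 * (k - 1) * x)
    (h : m * ((a + x) * n - a ^ 2 - Q) ≤ M * (s * (a + x)) + n * g) : False := by
  have hm0 : 0 < m := by linarith
  have hx : 0 < x := by linarith
  have ha : 0 < a := by linarith
  have hn0 : 0 ≤ n := by linarith
  have h1 := mul_le_mul_of_nonneg_left h (by linarith : 0 ≤ k)
  have h2 := mul_le_mul_of_nonneg_right hM (by positivity : 0 ≤ s * (a + x))
  have h3 := mul_le_mul_of_nonneg_left hg (by positivity : 0 ≤ k * n)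
  have h4 : 0 ≤ (p - 1) * (2 * x - p) := mul_nonneg (by linarith) (by linarith)
  have h5 : s * (a + x) ≤ 2 * (a * x) := by nlinarith
  have h6 : n ≤ 3 * a := by linarith
  have h7 : Q ≤ x ^ 2 := by nlinarith
  have h8 : k * m * (2 * (a * x) + s * (a + x)) ≤ k * (m * ((a + x) * n - a ^ 2 - Q)) := by
    rw [mul_assoc]
    refine mul_le_mul_of_nonneg_left (mul_le_mul_of_nonneg_left ?_ hm0.le) (by linarith)
    subst hn
    nlinarith
  have h9 : (k - 1) * m * (2 * (a * x)) ≤ k * n * (2 * (k - 1) * x) := by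
    have := mul_le_mul_of_nonneg_left h5 hm0.le
    nlinarith
  have h10 : m * a ≤ k * n := by
    refine le_of_mul_le_mul_left ?_ (by nlinarith : 0 < 2 * (k - 1) * x)
    linarith
  have h11 : k * n ≤ k * (3 * a) := mul_le_mul_of_nonneg_left h6 (by linarith)
  have h12 : m ≤ 3 * k := le_of_mul_le_mul_right (by linarith) ha
  linarith

/-- No part dominates, so the cruder bound on `g` over all parts suffices. With `M ≤ 3m/2`, the
factor `k - 1` cancels and `7R ≤ n(a + x)` remains, where `R` is too large. -/
theorem cut_inequality_false_of_ge {n s a x p Q g k m M : ℝ} (hn : n = s + a + x)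
    (hk : 2 ≤ k) (hm : 7 * (k - 1) ≤ m) (hM : k * M ≤ (k + 1) * m)
    (hs : 0 ≤ s) (ha : 1 ≤ a) (hax : a ≤ x) (hpx : p ≤ x) (hsp : s ≤ p) (hx : 3 ≤ x)
    (hQ : Q + a * p ≤ x + a * x) (hg : g ≤ (k - 1) * (a + x))
    (h : m * ((a + x) * n - a ^ 2 - Q) ≤ M * (s * (a + x)) + n * g) : False := by
  have hm0 : 0 < m := by linarith
  have hn0 : 0 ≤ n := by linarith
  have hsax : 0 ≤ s * (a + x) := by positivity
  have h1 : M ≤ 3 / 2 * m := by nlinarith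
  have h2 := mul_le_mul_of_nonneg_right h1 hsax
  have h3 := mul_le_mul_of_nonneg_left hg hn0
  have h4 : 0 ≤ a * (p - s) := mul_nonneg (by linarith) (by linarith)
  set R := a * x + x ^ 2 - x + a * s - s * (a + x) / 2 with hR
  have h5 : m * R ≤ (k - 1) * (n * (a + x)) := by
    have h6 : R ≤ (a + x) * n - a ^ 2 - Q - 3 / 2 * (s * (a + x)) := by
      subst hn
      rw [hR]
      nlinarith
    have := mul_le_mul_of_nonneg_left h6 hm0.le
    linarith
  have h6 : 0 ≤ (x - s) * x := mul_nonneg (by linarith) (by linarith)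
  have hR0 : 0 ≤ R := by rw [hR]; nlinarith
  have h7 : (k - 1) * (7 * R) ≤ (k - 1) * (n * (a + x)) := by
    have := mul_le_mul_of_nonneg_right hm hR0
    linarith
  have h8 := le_of_mul_le_mul_left h7 (by linarith : 0 < k - 1)
  subst hn
  rw [hR] at h8
  nlinarith [mul_nonneg (by linarith : 0 ≤ x - a) (by linarith : 0 ≤ a),
    mul_nonneg (by linarith : 0 ≤ a - 1) (by linarith : 0 ≤ x)]

namespace SimpleGraph

/-! ### Cuts, separated sets and degrees -/

section Bounds

variable {V : Type*} [Fintype V] [DecidableEq V] {G : SimpleGraph V} [DecidableRel G.Adj]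

theorem energy_indicator (A : Finset V) :
    G.energy (fun v => if v ∈ A then 1 else 0) =
      #{p : V × V | p.1 ∈ A ∧ p.2 ∉ A ∧ G.Adj p.1 p.2} := by
  have h1 : ∀ i j, (if G.Adj i j then
      ((if i ∈ A then (1 : ℝ) else 0) - if j ∈ A then 1 else 0) ^ 2 else 0) =
      (if i ∈ A ∧ j ∉ A ∧ G.Adj i j then 1 else 0) +
        if j ∈ A ∧ i ∉ A ∧ G.Adj j i then 1 else 0 := by
    intro i j
    by_cases hi : i ∈ A <;> by_cases hj : j ∈ A <;> by_cases h : G.Adj i j <;>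
      simp [hi, hj, h, G.adj_comm j i]
  have h2 : ∑ i, ∑ j, (if i ∈ A ∧ j ∉ A ∧ G.Adj i j then (1 : ℝ) else 0) =
      #{p : V × V | p.1 ∈ A ∧ p.2 ∉ A ∧ G.Adj p.1 p.2} := by
    rw [← Fintype.sum_prod_type', card_filter]
    push_cast
    rfl
  rw [energy]
  simp only [h1, sum_add_distrib]
  rw [sum_comm (f := fun i j => if j ∈ A ∧ i ∉ A ∧ G.Adj j i then (1 : ℝ) else 0), h2]
  ring

theorem sum_indicator_sq (A : Finset V) :
    ∑ v, (if v ∈ A then (1 : ℝ) else 0) ^ 2 = #A := by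
  simp

/-- An isoperimetric inequality and its converse. -/
theorem LaplacianBounds.cut {m M : ℝ} (h : G.LaplacianBounds m M) (A : Finset V) :
    m * (#A * (Fintype.card V - #A)) ≤
      Fintype.card V * (#{p : V × V | p.1 ∈ A ∧ p.2 ∉ A ∧ G.Adj p.1 p.2} : ℝ) ∧
    Fintype.card V * (#{p : V × V | p.1 ∈ A ∧ p.2 ∉ A ∧ G.Adj p.1 p.2} : ℝ) ≤
      M * (#A * (Fintype.card V - #A)) := by
  have h1 := h (fun v => if v ∈ A then 1 else 0)
  rw [energy_indicator, sum_indicator_sq] at h1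
  have h2 : ∑ v, (if v ∈ A then (1 : ℝ) else 0) = #A := by simp
  rw [h2] at h1
  constructor <;> nlinarith [h1.1, h1.2]

theorem energy_add_mul_of_separated {A B : Finset V} (hAB : Disjoint A B)
    (hadj : ∀ x ∈ A, ∀ y ∈ B, ¬ G.Adj x y) (t : ℝ) :
    G.energy (fun v => (if v ∈ A then 1 else 0) + t * if v ∈ B then 1 else 0) =
      G.energy (fun v => if v ∈ A then 1 else 0) +
        t ^ 2 * G.energy (fun v => if v ∈ B then 1 else 0) := by
  simp only [energy]
  rw [mul_div_assoc', mul_sum, ← add_div, ← sum_add_distrib]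
  congr 1
  refine sum_congr rfl fun i _ => ?_
  rw [mul_sum, ← sum_add_distrib]
  refine sum_congr rfl fun j _ => ?_
  by_cases h : G.Adj i j
  · have hiA : i ∈ A → i ∉ B := fun h => Finset.disjoint_left.mp hAB h
    have hjA : j ∈ A → j ∉ B := fun h => Finset.disjoint_left.mp hAB h
    have h1 : i ∈ A → j ∉ B := fun h1 h2 => hadj i h1 j h2 h
    have h2 : j ∈ A → i ∉ B := fun h1 h2 => hadj j h1 i h2 h.symm
    by_cases hi : i ∈ A <;> by_cases hj : j ∈ A <;> by_cases hi' : i ∈ B <;>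
      by_cases hj' : j ∈ B <;> simp_all
  · simp [h]

/-- Separated vertex sets are small when the nontrivial Laplacian eigenvalues are close to each
other. -/
theorem LaplacianBounds.separated {m M : ℝ} {k : ℕ} (h : G.LaplacianBounds m M) (hm : 0 < m)
    (hM : k * M ≤ (k + 1) * m) {A B : Finset V} (hAB : Disjoint A B)
    (hadj : ∀ x ∈ A, ∀ y ∈ B, ¬ G.Adj x y) :
    (2 * (k : ℝ) + 1) ^ 2 * (#A * #B) ≤
      (Fintype.card V - #A) * (Fintype.card V - #B) := by
  set n : ℝ := (Fintype.card V : ℝ) with hn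
  have hA : (#A : ℝ) ≤ n := Nat.cast_le.mpr A.card_le_univ
  have hB : (#B : ℝ) ≤ n := Nat.cast_le.mpr B.card_le_univ
  have hA0 : (0 : ℝ) ≤ #A := by positivity
  have hB0 : (0 : ℝ) ≤ #B := by positivity
  set X : ℝ := (#A : ℝ)
  set Y : ℝ := (#B : ℝ)
  have hsum : ∀ t : ℝ,
      ∑ v, ((if v ∈ A then (1 : ℝ) else 0) + t * if v ∈ B then 1 else 0) = X + t * Y := by
    intro t
    rw [sum_add_distrib, ← mul_sum]
    simp [X, Y]
  have hsq : ∀ t : ℝ,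
      ∑ v, ((if v ∈ A then (1 : ℝ) else 0) + t * if v ∈ B then 1 else 0) ^ 2 =
        X + t ^ 2 * Y := by
    intro t
    have : ∀ v, ((if v ∈ A then (1 : ℝ) else 0) + t * if v ∈ B then 1 else 0) ^ 2 =
        (if v ∈ A then (1 : ℝ) else 0) + t ^ 2 * if v ∈ B then 1 else 0 := by
      intro v
      have : v ∈ A → v ∉ B := fun h => Finset.disjoint_left.mp hAB h
      by_cases h1 : v ∈ A <;> by_cases h2 : v ∈ B <;> simp_all
    simp only [this]
    rw [sum_add_distrib, ← mul_sum]
    simp [X, Y]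
  have key : ∀ t : ℝ, (4 * k + 2) * t * (X * Y) ≤
      (n * X - X ^ 2) + t ^ 2 * (n * Y - Y ^ 2) := by
    intro t
    -- Without edges between `A` and `B`, the vectors `1_A - t 1_B` and `1_A + t 1_B` have equal
    -- energy. The lower bound for the first is compared with the upper bound for the second.
    have h1 := (h (fun v => (if v ∈ A then 1 else 0) + (-t) * if v ∈ B then 1 else 0)).1
    have h2 := (h (fun v => (if v ∈ A then 1 else 0) + t * if v ∈ B then 1 else 0)).2
    rw [energy_add_mul_of_separated hAB hadj, hsum, hsq] at h1 h2
    rw [neg_sq] at h1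
    have h3 := h1.trans h2
    have h4 := mul_le_mul_of_nonneg_left h3 (by positivity : (0 : ℝ) ≤ k)
    have h5 : 0 ≤ n * (X + t ^ 2 * Y) - (X + t * Y) ^ 2 := by
      have := sq_sum_le_card_mul_sum_sq (s := univ)
        (f := fun v => (if v ∈ A then (1 : ℝ) else 0) + t * if v ∈ B then 1 else 0)
      rw [hsum, hsq, card_univ, ← hn] at this
      linarith
    have h6 := mul_le_mul_of_nonneg_right hM h5
    have h7 : m * (k * (n * (X + t ^ 2 * Y) - (X + -t * Y) ^ 2)) ≤
        m * ((k + 1) * (n * (X + t ^ 2 * Y) - (X + t * Y) ^ 2)) := by linarith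
    have h8 := le_of_mul_le_mul_left h7 hm
    linarith
  rcases hB.eq_or_lt with hBn | hBn
  · have : X = 0 := by
      have h1 : #A + #B ≤ Fintype.card V := by
        rw [← card_union_of_disjoint hAB]; exact card_le_univ _
      have h2 : ((#A + #B : ℕ) : ℝ) ≤ n := Nat.cast_le.mpr h1
      push_cast at h2
      linarith
    rw [this, hBn]
    simp
  rcases hB0.eq_or_lt with hBz | hBz
  · rw [← hBz]
    nlinarith
  rcases hA0.eq_or_lt with hAz | hAz
  · rw [← hAz]
    nlinarith
  have hβ : 0 < n - Y := by linarith
  -- This `t` minimises the quadratic polynomial in `key`.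
  have h1 := key ((2 * k + 1) * X / (n - Y))
  have h2 : (2 * (k : ℝ) + 1) ^ 2 * X ^ 2 * Y / (n - Y) ≤ n * X - X ^ 2 := by
    have e1 : (4 * (k : ℝ) + 2) * ((2 * k + 1) * X / (n - Y)) * (X * Y) =
        2 * ((2 * (k : ℝ) + 1) ^ 2 * X ^ 2 * Y / (n - Y)) := by ring
    have e2 : ((2 * (k : ℝ) + 1) * X / (n - Y)) ^ 2 * (n * Y - Y ^ 2) =
        (2 * (k : ℝ) + 1) ^ 2 * X ^ 2 * Y / (n - Y) := by
      field_simp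
    rw [e1, e2] at h1
    linarith
  rw [div_le_iff₀ hβ] at h2
  refine le_of_mul_le_mul_left ?_ hAz
  linarith

theorem LaplacianBounds.degree_le {m M : ℝ} (h : G.LaplacianBounds m M) (v : V) :
    Fintype.card V * (G.degree v : ℝ) ≤ M * (Fintype.card V - 1) := by
  have h1 := (h.cut {v}).2
  have h2 : #{p : V × V | p.1 ∈ ({v} : Finset V) ∧ p.2 ∉ ({v} : Finset V) ∧ G.Adj p.1 p.2} =
      G.degree v := by
    rw [← card_neighborFinset_eq_degree]
    refine card_bij' (fun p _ => p.2) (fun w _ => (v, w)) ?_ ?_ ?_ ?_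
    · rintro ⟨a, b⟩ hp
      simp only [mem_filter, mem_univ, true_and, mem_singleton] at hp
      obtain ⟨rfl, -, hp⟩ := hp
      simpa using hp
    · intro w hw
      simp only [mem_neighborFinset] at hw
      simp [hw, hw.ne']
    · rintro ⟨a, b⟩ hp
      simp only [mem_filter, mem_univ, true_and, mem_singleton] at hp
      rw [hp.1]
    · intro w hw
      rfl
  rw [h2] at h1
  simpa using h1

theorem LaplacianBounds.degree_separated {m M : ℝ} {k : ℕ} (h : G.LaplacianBounds m M)
    (hm : 0 < m) (hM : k * M ≤ (k + 1) * m) (v : V) :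
    (2 * (k : ℝ) + 1) ^ 2 * (Fintype.card V - 1 - G.degree v) ≤
      (Fintype.card V - 1) * (G.degree v + 1) := by
  have h1 := h.separated hm hM (A := {v}) (B := Gᶜ.neighborFinset v) (by simp) (by
    intro x hx y hy
    rw [mem_singleton] at hx
    subst hx
    rw [mem_neighborFinset, compl_adj] at hy
    exact hy.2)
  rw [card_neighborFinset_eq_degree, degree_compl, card_singleton] at h1
  have h2 : G.degree v + 1 ≤ Fintype.card V := G.degree_lt_card_verts v
  rw [Nat.sub_sub, Nat.cast_sub (by omega)] at h1
  push_cast at h1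
  linarith

/-- A graph with few vertices satisfying the eigenvalue condition is complete. -/
theorem LaplacianBounds.eq_top {m M : ℝ} {k : ℕ} (h : G.LaplacianBounds m M)
    (hm : 0 < m) (hM : k * M ≤ (k + 1) * m)
    (hn : Fintype.card V ≤ 2 * k + 1) : G = ⊤ := by
  ext v w
  rw [top_adj]
  refine ⟨fun h => h.ne, fun hvw => ?_⟩
  by_contra hadj
  have h1 := h.separated hm hM (A := {v}) (B := {w}) (by simpa using hvw)
    (by simpa using hadj)
  have hn' : (Fintype.card V : ℝ) ≤ 2 * k + 1 := by exact_mod_cast hn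
  have h2 : (1 : ℝ) ≤ Fintype.card V := by
    exact_mod_cast Fintype.card_pos_iff.mpr ⟨v⟩
  simp only [card_singleton, Nat.cast_one] at h1
  nlinarith

end Bounds

/-! ### Partitions with too many parts contradict the eigenvalue bounds -/

section Partition

variable {V : Type*} [Fintype V] [DecidableEq V] {G : SimpleGraph V} [DecidableRel G.Adj]
  {F : SimpleGraph V} [DecidableRel F.Adj] {ι : Type*} [DecidableEq ι]
  {S : Finset V} {f : V → ι} {k : ℕ}

theorem card_filter_fst_mem_adj_le {D : ℕ} (T : Finset V) (hT : ∀ x ∈ T, F.degree x ≤ D) :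
    #{p : V × V | p.1 ∈ T ∧ F.Adj p.1 p.2} ≤ D * #T := by
  refine card_le_mul_card_image_of_maps_to (f := Prod.fst) (by simp +contextual) D fun x hx => ?_
  refine le_trans ?_ (hT x hx)
  rw [← card_neighborFinset_eq_degree]
  refine card_le_card_of_injOn Prod.snd ?_ ?_
  · rintro ⟨a, b⟩ hp
    simp only [mem_coe, mem_filter, mem_univ, true_and] at hp
    obtain ⟨⟨-, h⟩, rfl⟩ := hp
    simpa using h
  · rintro ⟨a, b⟩ hp ⟨a', b'⟩ hp' h
    simp only [mem_coe, mem_filter, mem_univ, true_and] at hp hp'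
    simp_all

theorem sum_card_fiber [Fintype ι] (S : Finset V) (f : V → ι) :
    #S + ∑ i, #{x | x ∉ S ∧ f x = i} = Fintype.card V := by
  have h := card_eq_sum_card_fiberwise (f := f) (s := Sᶜ) (t := univ) (fun _ _ => mem_univ _)
  have h1 : ∀ i, ({x ∈ Sᶜ | f x = i} : Finset V) =
      ({x | x ∉ S ∧ f x = i} : Finset V) := by
    intro i; ext x; simp
  simp only [h1] at h
  rw [← h, card_compl]
  have := S.card_le_univ
  omega

theorem degree_add_two_le_card_fiber (hF : ∀ x ∉ S, F.degree x + 1 ≤ k)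
    (hGF : ∀ x ∉ S, ∀ y ∉ S, G.Adj x y → ¬ F.Adj x y → f x = f y) {x : V} (hx : x ∉ S) :
    G.degree x + 2 ≤ #{y | y ∉ S ∧ f y = f x} + #S + k := by
  have h1 : insert x (G.neighborFinset x) ⊆
      ({y | y ∉ S ∧ f y = f x} : Finset V) ∪ S ∪ F.neighborFinset x := by
    intro y hy
    simp only [mem_insert, mem_neighborFinset] at hy
    simp only [mem_union, mem_filter, mem_univ, true_and, mem_neighborFinset]
    rcases hy with rfl | hy
    · simp [hx]
    · by_cases hyS : y ∈ S
      · simp [hyS]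
      · by_cases hFy : F.Adj x y
        · simp [hFy]
        · simp [hyS, hGF x hx y hyS hy hFy]
  have h2 := (card_le_card h1).trans
    ((card_union_le _ _).trans (Nat.add_le_add_right (card_union_le _ _) _))
  rw [card_insert_of_notMem (by simp), card_neighborFinset_eq_degree,
    card_neighborFinset_eq_degree] at h2
  have := hF x hx
  omega

variable [Fintype ι]

/-- Neighbours of a vertex outside `S` lie in its own part, in `S`, or among at most `k - 1`
neighbours in `F`, so every part has at least `d + 2 - |S| - k` vertices. This is summed over at
least `max (|S| + 1) 2` parts. -/
theorem lt_card_of_minDegree {d : ℕ} (hd : ∀ v, d ≤ G.degree v)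
    (hF : ∀ x ∉ S, F.degree x + 1 ≤ k) (hf : ∀ i, ∃ x ∉ S, f x = i)
    (hGF : ∀ x ∉ S, ∀ y ∉ S, G.Adj x y → ¬ F.Adj x y → f x = f y)
    (hS : #S + 1 ≤ Fintype.card ι) (hι : 2 ≤ Fintype.card ι) :
    2 * d + 2 < Fintype.card V + 2 * k := by
  by_contra! hcon
  have h1 : ∀ i, 1 ≤ #{x | x ∉ S ∧ f x = i} ∧ d + 2 ≤ #{x | x ∉ S ∧ f x = i} + #S + k := by
    intro i
    obtain ⟨x, hx, rfl⟩ := hf i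
    exact ⟨card_pos.mpr ⟨x, by simp [hx]⟩,
      (Nat.add_le_add_right (hd x) 2).trans (degree_add_two_le_card_fiber hF hGF hx)⟩
  have h2 := sum_card_fiber S f
  have h3 : Fintype.card ι • 1 ≤ ∑ i, #{x | x ∉ S ∧ f x = i} :=
    card_nsmul_le_sum _ _ _ fun i _ => (h1 i).1
  have h4 : Fintype.card ι • (d + 2 - #S - k) ≤ ∑ i, #{x | x ∉ S ∧ f x = i} :=
    card_nsmul_le_sum _ _ _ fun i _ => by have := (h1 i).2; omega
  rw [smul_eq_mul] at h3 h4
  rcases le_or_gt (d + 2) (#S + k + 1) with h5 | h5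
  · omega
  · obtain ⟨e, he⟩ : ∃ e, d + 2 = #S + k + 1 + e := ⟨d + 2 - (#S + k + 1), by omega⟩
    have h6 : d + 2 - #S - k = e + 1 := by omega
    rw [h6] at h4
    rcases Nat.eq_zero_or_pos #S with h7 | h7
    · have := Nat.mul_le_mul_right (e + 1) hι
      omega
    · have := Nat.mul_le_mul_right (e + 1) hS
      have h8 : e ≤ #S * e := Nat.le_mul_of_pos_left e h7
      have h9 : (#S + 1) * (e + 1) = #S * e + #S + e + 1 := by ring
      omega

/-- Counting the edges between the parts of a partition of `Sᶜ`. -/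
theorem sum_card_cut_le (i₀ : ι) (hk : 1 ≤ k) (hF : ∀ x ∉ S, F.degree x + 1 ≤ k)
    (hGF : ∀ x ∉ S, ∀ y ∉ S, G.Adj x y → ¬ F.Adj x y → f x = f y) :
    ∃ g : ℕ, ∑ i, #{p : V × V | p.1 ∈ ({x | x ∉ S ∧ f x = i} : Finset V) ∧
        p.2 ∉ ({x | x ∉ S ∧ f x = i} : Finset V) ∧ G.Adj p.1 p.2} ≤
      #{p : V × V | p.1 ∈ Sᶜ ∧ p.2 ∉ Sᶜ ∧ G.Adj p.1 p.2} + g ∧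
      g ≤ (k - 1) * ∑ i, #{x | x ∉ S ∧ f x = i} ∧
      g ≤ 2 * (k - 1) * ∑ i ∈ univ.erase i₀, #{x | x ∉ S ∧ f x = i} := by
  -- `g` counts ordered `F`-adjacent pairs in different parts. Each has an endpoint outside part
  -- `i₀`, whence the factor 2 in the last bound.
  refine ⟨#{p : V × V | p.1 ∉ S ∧ p.2 ∉ S ∧ f p.1 ≠ f p.2 ∧ F.Adj p.1 p.2}, ?_, ?_, ?_⟩
  · have h := card_eq_sum_card_fiberwise (f := fun p : V × V => f p.1) (t := univ)
      (s := {p : V × V | p.1 ∉ S ∧ ¬ (p.2 ∉ S ∧ f p.2 = f p.1) ∧ G.Adj p.1 p.2})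
      (fun _ _ => mem_univ _)
    have h1 : ∀ i, ({p ∈ ({p : V × V | p.1 ∉ S ∧ ¬ (p.2 ∉ S ∧ f p.2 = f p.1) ∧ G.Adj p.1 p.2} :
        Finset (V × V)) | f p.1 = i} : Finset (V × V)) =
        ({p : V × V | p.1 ∈ ({x | x ∉ S ∧ f x = i} : Finset V) ∧
        p.2 ∉ ({x | x ∉ S ∧ f x = i} : Finset V) ∧ G.Adj p.1 p.2} : Finset (V × V)) := by
      intro i
      ext p
      simp only [mem_filter, mem_univ, true_and]
      constructor
      · rintro ⟨⟨h1, h2, h3⟩, rfl⟩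
        exact ⟨⟨h1, rfl⟩, h2, h3⟩
      · rintro ⟨⟨h1, rfl⟩, h2, h3⟩
        exact ⟨⟨h1, h2, h3⟩, rfl⟩
    simp only [h1] at h
    rw [← h]
    refine le_trans (card_le_card ?_) (card_union_le _ _)
    rintro p hp
    simp only [mem_filter, mem_univ, true_and, mem_union, mem_compl, not_not] at hp ⊢
    obtain ⟨hp1, hp2, hp3⟩ := hp
    by_cases h2 : p.2 ∈ S
    · exact Or.inl ⟨hp1, h2, hp3⟩
    · have h3 : f p.1 ≠ f p.2 := fun h => hp2 ⟨h2, h.symm⟩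
      refine Or.inr ⟨hp1, h2, h3, ?_⟩
      by_contra h4
      exact h3 (hGF _ hp1 _ h2 hp3 h4)
  · have h1 := card_filter_fst_mem_adj_le (F := F) (D := k - 1) Sᶜ
      (fun x hx => by have := hF x (by simpa using hx); omega)
    have h2 := sum_card_fiber S f
    have h3 : #Sᶜ = ∑ i, #{x | x ∉ S ∧ f x = i} := by
      have := S.card_le_univ
      rw [card_compl]; omega
    rw [h3] at h1
    refine le_trans (card_le_card ?_) h1
    intro p hp
    simp only [mem_filter, mem_univ, true_and, mem_compl] at hp ⊢
    exact ⟨hp.1, hp.2.2.2⟩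
  · set T : Finset V := {x | x ∉ S ∧ f x ≠ i₀}
    have h1 := card_filter_fst_mem_adj_le (F := F) (D := k - 1) T
      (fun x hx => by have := hF x (by simp [T] at hx; exact hx.1); omega)
    have h3 : #T = ∑ i ∈ univ.erase i₀, #{x | x ∉ S ∧ f x = i} := by
      rw [card_eq_sum_card_fiberwise (f := f) (t := univ.erase i₀)
        (fun x hx => by simpa [T] using (by simp [T] at hx; exact hx.2))]
      refine sum_congr rfl fun i hi => ?_
      congr 1
      ext x
      simp only [T, mem_filter, mem_univ, true_and]
      rw [mem_erase] at hi
      constructor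
      · rintro ⟨⟨h1, h2⟩, rfl⟩
        exact ⟨h1, rfl⟩
      · rintro ⟨h1, rfl⟩
        exact ⟨⟨h1, hi.1⟩, rfl⟩
    have h4 : #{p : V × V | p.2 ∈ T ∧ F.Adj p.1 p.2} =
        #{p : V × V | p.1 ∈ T ∧ F.Adj p.1 p.2} := by
      refine card_bij' (fun p _ => p.swap) (fun p _ => p.swap) ?_ ?_ ?_ ?_ <;>
        simp +contextual [F.adj_comm]
    rw [← h3, mul_assoc, two_mul]
    refine le_trans (le_trans (card_le_card ?_) (card_union_le
      ({p : V × V | p.1 ∈ T ∧ F.Adj p.1 p.2} : Finset (V × V))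
      {p : V × V | p.2 ∈ T ∧ F.Adj p.1 p.2}))
      (Nat.add_le_add h1 (h4.trans_le h1))
    intro p hp
    simp only [T, mem_filter, mem_univ, true_and, mem_union] at hp ⊢
    obtain ⟨hp1, hp2, hp3, hp4⟩ := hp
    by_cases h : f p.1 = i₀
    · exact Or.inr ⟨⟨hp2, fun h' => hp3 (h.trans h'.symm)⟩, hp4⟩
    · exact Or.inl ⟨⟨hp1, h⟩, hp4⟩

/-- Sum of `(a i - 1) * (b - a i) ≥ 0`. -/
theorem sum_sq_add_mul_card_le {ι : Type*} {J : Finset ι} {a : ι → ℕ} {b : ℕ} (h1 : ∀ i ∈ J, 1 ≤ a i)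
    (hb : ∀ i ∈ J, a i ≤ b) :
    ∑ i ∈ J, a i ^ 2 + b * #J ≤ ∑ i ∈ J, a i + b * ∑ i ∈ J, a i := by
  rw [mul_comm, ← smul_eq_mul, ← sum_const, ← sum_add_distrib, mul_sum, ← sum_add_distrib]
  refine sum_le_sum fun i hi => ?_
  obtain ⟨c, hc⟩ := Nat.exists_eq_add_of_le (h1 i hi)
  have h2 := Nat.mul_le_mul_right c (hb i hi)
  rw [hc] at h2 ⊢
  nlinarith

theorem add_card_le_sum_add_one {ι : Type*} [DecidableEq ι] {J : Finset ι} {a : ι → ℕ} (h1 : ∀ i ∈ J, 1 ≤ a i) {i : ι}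
    (hi : i ∈ J) : a i + #J ≤ ∑ i ∈ J, a i + 1 := by
  rw [← add_sum_erase J a hi]
  have h2 : #(J.erase i) • 1 ≤ ∑ i ∈ J.erase i, a i :=
    card_nsmul_le_sum _ _ _ fun j hj => h1 j (mem_of_mem_erase hj)
  have h3 := card_erase_add_one hi
  rw [smul_eq_mul] at h2
  omega

/-- If the nontrivial Laplacian eigenvalues are close to each other, then removing the edges of a
graph `F` of maximum degree less than `k` and a set `S` of vertices does not leave more
than `#S` components. -/
theorem LaplacianBounds.false_of_partition {m M : ℝ} (h : G.LaplacianBounds m M)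
    (hm : 0 < m) (hM : k * M ≤ (k + 1) * m) (hk : 1 ≤ k) (hn : 2 * k ≤ Fintype.card V)
    (hF : ∀ x ∉ S, F.degree x + 1 ≤ k) (hf : ∀ i, ∃ x ∉ S, f x = i)
    (hGF : ∀ x ∉ S, ∀ y ∉ S, G.Adj x y → ¬ F.Adj x y → f x = f y)
    (hS : #S + 1 ≤ Fintype.card ι) (hι : 2 ≤ Fintype.card ι)
    (hk1 : k = 1 → #S + 2 ≤ Fintype.card ι) : False := by
  have : Nonempty ι := Fintype.card_pos_iff.mp (by omega)
  have : Nonempty V := Fintype.card_pos_iff.mp (by omega)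
  set a : ι → ℕ := fun i => #{x | x ∉ S ∧ f x = i} with ha
  obtain ⟨i₀, -, hi₀⟩ := exists_max_image univ a univ_nonempty
  obtain ⟨g, hg, hg1, hg2⟩ := sum_card_cut_le i₀ hk hF hGF
  have ha1 : ∀ i, 1 ≤ a i := fun i => by
    obtain ⟨x, hx, rfl⟩ := hf i
    exact card_pos.mpr ⟨x, by simp [hx]⟩
  have hsum : #S + ∑ i, a i = Fintype.card V := sum_card_fiber S f
  have hsplit : a i₀ + ∑ i ∈ univ.erase i₀, a i = ∑ i, a i := add_sum_erase _ _ (mem_univ _)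
  have hsplit2 : a i₀ ^ 2 + ∑ i ∈ univ.erase i₀, a i ^ 2 = ∑ i, a i ^ 2 :=
    add_sum_erase _ (fun i => a i ^ 2) (mem_univ _)
  change g ≤ (k - 1) * ∑ i, a i at hg1
  change g ≤ 2 * (k - 1) * ∑ i ∈ univ.erase i₀, a i at hg2
  set p := #((univ : Finset ι).erase i₀) with hp
  set x := ∑ i ∈ univ.erase i₀, a i with hx
  set Q := ∑ i ∈ univ.erase i₀, a i ^ 2 with hQ
  have hpι : p + 1 = Fintype.card ι := by
    rw [hp, card_erase_add_one (mem_univ _), card_univ]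
  have hpx : p ≤ x := by
    have : p • 1 ≤ x := card_nsmul_le_sum _ _ _ fun i _ => ha1 i
    simpa using this
  have hQ1 : Q + a i₀ * p ≤ x + a i₀ * x :=
    sum_sq_add_mul_card_le (fun i _ => ha1 i) fun i _ => hi₀ i (mem_univ i)
  -- A part other than `i₀` has at most `x - p + 1` vertices, since the remaining `p - 1` are
  -- nonempty.
  have hQ2 : Q + (x - p + 1) * p ≤ x + (x - p + 1) * x :=
    sum_sq_add_mul_card_le (fun i _ => ha1 i) fun i hi => by
      have := add_card_le_sum_add_one (fun i _ => ha1 i) hi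
      omega
  set n : ℝ := (Fintype.card V : ℝ) with hndef
  have hnR : n = #S + a i₀ + x := by
    rw [hndef, ← hsum, ← hsplit]; push_cast; ring
  -- The lower cut bounds of all parts are summed and compared with the upper cut bound of `Sᶜ`.
  have hcut : m * ((a i₀ + x) * n - (a i₀ : ℝ) ^ 2 - Q) ≤ M * (#S * (a i₀ + x)) + n * g := by
    have h1 : ∑ i, m * (a i * (n - a i)) ≤
        ∑ i, n * (#{p : V × V | p.1 ∈ ({x | x ∉ S ∧ f x = i} : Finset V) ∧
        p.2 ∉ ({x | x ∉ S ∧ f x = i} : Finset V) ∧ G.Adj p.1 p.2} : ℝ) :=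
      sum_le_sum fun i _ => (h.cut {x | x ∉ S ∧ f x = i}).1
    have h2 := (h.cut Sᶜ).2
    have h3 : (#Sᶜ : ℝ) = a i₀ + x := by
      have h4 : #Sᶜ + #S = Fintype.card V := by rw [add_comm]; exact card_add_card_compl S
      have h5 : (#Sᶜ : ℝ) + #S = n := by rw [hndef, ← h4]; push_cast; rfl
      linarith
    rw [h3] at h2
    have h4 : n - (a i₀ + x) = #S := by linarith
    rw [← hndef, h4] at h2
    rw [← mul_sum, ← mul_sum] at h1
    have h5 : ∑ i, (a i : ℝ) * (n - a i) = (a i₀ + x) * n - (a i₀ : ℝ) ^ 2 - Q := by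
      have e1 : ∑ i, (a i : ℝ) * (n - a i) = (∑ i, a i : ℕ) * n - (∑ i, a i ^ 2 : ℕ) := by
        push_cast
        rw [sum_mul, ← sum_sub_distrib]
        exact sum_congr rfl fun i _ => by ring
      rw [e1, ← hsplit, ← hsplit2]
      push_cast
      ring
    rw [h5] at h1
    have h6 : (0 : ℝ) ≤ n := by rw [hndef]; positivity
    have h7 := mul_le_mul_of_nonneg_left (Nat.cast_le (α := ℝ).mpr hg) h6
    push_cast at h7
    rw [mul_add] at h7
    refine h1.trans (h7.trans ?_)
    linarith
  have ha0 : (1 : ℝ) ≤ a i₀ := by exact_mod_cast ha1 i₀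
  have hpx' : (p : ℝ) ≤ x := by exact_mod_cast hpx
  have hQ1' : (Q : ℝ) + a i₀ * p ≤ x + a i₀ * x := by exact_mod_cast hQ1
  rcases hk.eq_or_lt with hk' | hk2
  · subst hk'
    have hg0 : g = 0 := by simpa using hg1
    rw [hg0] at hcut
    rw [Nat.cast_zero, mul_zero, add_zero] at hcut
    refine cut_inequality_false_of_one hnR hm ?_ (Nat.cast_nonneg _) ha0
      hpx' (Nat.cast_nonneg _) ?_ hQ1' hcut
    · rw [Nat.cast_one] at hM
      linarith
    have := hk1 rfl
    have h1 : #S + 1 ≤ p := by omega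
    exact_mod_cast h1
  have hk2' : (2 : ℝ) ≤ k := by exact_mod_cast hk2
  have hsp : (#S : ℝ) ≤ p := by
    have : #S ≤ p := by omega
    exact_mod_cast this
  obtain ⟨v, hv⟩ := G.exists_minimal_degree_vertex
  have hlt := lt_card_of_minDegree (G := G) (d := G.degree v)
    (fun w => hv ▸ G.minDegree_le_degree w) hF hf hGF hS hι
  have hK := h.degree_separated hm hM v
  have hdeg := h.degree_le v
  rw [← hndef] at hK hdeg
  have hlt' : 2 * (G.degree v : ℝ) + 3 ≤ n + 2 * k := by
    rw [hndef]; exact_mod_cast hlt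
  have hn2 : 2 * (k : ℝ) + 2 ≤ n := by
    -- Otherwise `G` is complete, so `d = n - 1`, and `hlt` gives `n < 2k`.
    by_contra! hcon
    have h1 : Fintype.card V ≤ 2 * k + 1 := by
      rw [hndef] at hcon
      have : Fintype.card V < 2 * k + 2 := by exact_mod_cast hcon
      omega
    have h2 := h.eq_top hm hM h1
    have h3 : G.degree v + 1 = Fintype.card V := by
      have : G.degree v = Fintype.card V - 1 := by
        subst h2
        convert complete_graph_degree v
      omega
    omega
  have hn4 : 4 * k ^ 2 + 3 ≤ Fintype.card V := by
    have h1 := four_mul_sq_add_three_le_of_degree_bounds hn2 (by positivity) hlt' hK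
    rw [hndef] at h1
    have : 4 * k ^ 2 + 2 < Fintype.card V := by exact_mod_cast h1
    omega
  have hm7 := seven_mul_le_of_degree_bounds hk2
    (by rw [hndef]; exact_mod_cast hn4) hK hdeg hM
  have hkcast : ((k - 1 : ℕ) : ℝ) = k - 1 := by rw [Nat.cast_sub hk]; simp
  rcases le_total x (a i₀) with hxa | hxa
  · refine cut_inequality_false_of_le hnR hk2' hm7 hM (by positivity) (by exact_mod_cast hxa)
      hpx' hsp ?_ ?_ ?_ hcut
    · have h1 : 1 ≤ p := by omega
      exact_mod_cast h1
    · have h1 : ((x - p : ℕ) : ℝ) = x - p := Nat.cast_sub hpx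
      rw [← h1]
      exact_mod_cast hQ2
    · rw [← hkcast]
      exact_mod_cast hg2
  · refine cut_inequality_false_of_ge hnR hk2' hm7 hM (by positivity) ha0 (by exact_mod_cast hxa)
      hpx' hsp ?_ hQ1' ?_ hcut
    · have h1 : 4 * 2 ^ 2 ≤ 4 * k ^ 2 := by gcongr; exact hk2
      have h2 : 3 ≤ x := by omega
      exact_mod_cast h2
    · rw [← hkcast]
      rw [← hsplit] at hg1
      exact_mod_cast hg1

end Partition

/-! ### Tutte's theorem after deleting vertices -/

/-- Tutte's theorem for the graph obtained by deleting a set `W` of vertices. -/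
theorem exists_matching_or_exists_partition.{u} {V : Type u} [Fintype V] [DecidableEq V]
    (G : SimpleGraph V) (W : Finset V) (hW : Even #Wᶜ) :
    (∃ M : SimpleGraph V, M ≤ G ∧ (∀ v ∈ W, ∀ w, ¬ M.Adj v w) ∧ ∀ v ∉ W, ∃! w, M.Adj v w) ∨
    ∃ (S : Finset V) (ι : Type u) (_ : Fintype ι) (_ : DecidableEq ι) (f : V → ι),
      W ⊆ S ∧ (∀ i, ∃ x ∉ S, f x = i) ∧ (∀ x ∉ S, ∀ y ∉ S, G.Adj x y → f x = f y) ∧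
      #S + 2 ≤ Fintype.card ι + #W := by
  classical
  set H : SimpleGraph {v // v ∉ W} := G.comap Subtype.val with hH
  by_cases hT : ∃ M : Subgraph H, M.IsPerfectMatching
  · left
    obtain ⟨M, hM⟩ := hT
    rw [Subgraph.isPerfectMatching_iff] at hM
    refine ⟨M.spanningCoe.map (Function.Embedding.subtype _), ?_, ?_, ?_⟩
    · intro v w hvw
      rw [map_adj] at hvw
      obtain ⟨a, b, hab, rfl, rfl⟩ := hvw
      exact M.adj_sub hab
    · intro v hv w hvw
      rw [map_adj] at hvw
      obtain ⟨a, b, hab, rfl, rfl⟩ := hvw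
      exact a.2 hv
    · intro v hv
      obtain ⟨b, hb, hb'⟩ := hM ⟨v, hv⟩
      refine ⟨b, ?_, ?_⟩
      · simp only [map_adj]
        exact ⟨⟨v, hv⟩, b, hb, rfl, rfl⟩
      · intro w hw
        simp only [map_adj] at hw
        obtain ⟨a, c, hac, ha, rfl⟩ := hw
        have : a = ⟨v, hv⟩ := Subtype.ext ha
        subst this
        rw [hb' c hac]
        rfl
  · right
    rw [tutte] at hT
    push Not at hT
    obtain ⟨u, hu⟩ := hT
    rw [IsTutteViolator] at hu
    set K := ((⊤ : H.Subgraph).deleteVerts u).coe with hK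
    have hparity := odd_ncard_oddComponents K
    have hle : K.oddComponents.ncard ≤ Fintype.card K.ConnectedComponent := by
      rw [← Nat.card_eq_fintype_card, ← Set.ncard_univ]
      exact Set.ncard_le_ncard (Set.subset_univ _) Set.finite_univ
    have hcard : Nat.card ((⊤ : H.Subgraph).deleteVerts u).verts + u.ncard = #Wᶜ := by
      have h1 : ((⊤ : H.Subgraph).deleteVerts u).verts = uᶜ := by ext; simp
      rw [h1, Nat.card_coe_set_eq, add_comm, Set.ncard_add_ncard_compl]
      rw [Nat.card_eq_fintype_card, Fintype.card_subtype]
      congr 1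
      ext; simp
    have hne : Nonempty K.ConnectedComponent := Fintype.card_pos_iff.mp (by omega)
    have hmem : ∀ x (h : ∃ h : x ∉ W, (⟨x, h⟩ : {v // v ∉ W}) ∉ u),
        (⟨x, h.1⟩ : {v // v ∉ W}) ∈ ((⊤ : H.Subgraph).deleteVerts u).verts := by
      rintro x ⟨h1, h2⟩
      simp [h2]
    set S : Finset V := W ∪ u.toFinset.map (Function.Embedding.subtype _) with hS
    have hxS : ∀ x, x ∉ S → ∃ h : x ∉ W, (⟨x, h⟩ : {v // v ∉ W}) ∉ u := by
      intro x hx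
      simp only [hS, mem_union, not_or] at hx
      exact ⟨hx.1, fun h => hx.2 (by simp [h, hx.1])⟩
    -- All components serve as parts, not only the odd ones. The value of `f` on `S` is arbitrary.
    refine ⟨S, K.ConnectedComponent, inferInstance, inferInstance,
      fun x => if h : ∃ h : x ∉ W, (⟨x, h⟩ : {v // v ∉ W}) ∉ u then
        K.connectedComponentMk ⟨⟨x, h.1⟩, hmem x h⟩ else hne.some,
      subset_union_left, ?_, ?_, ?_⟩
    · intro i
      induction i using ConnectedComponent.ind with | _ x
      obtain ⟨⟨x, hxW⟩, hx⟩ := x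
      have hxu : (⟨x, hxW⟩ : {v // v ∉ W}) ∉ u := by simpa using hx
      refine ⟨x, ?_, ?_⟩
      · simp [hS, hxW, hxu]
      · exact dif_pos ⟨hxW, hxu⟩
    · intro x hx y hy hxy
      beta_reduce
      rw [dif_pos (hxS x hx), dif_pos (hxS y hy)]
      apply ConnectedComponent.connectedComponentMk_eq_of_adj
      simp only [hK, Subgraph.coe_adj, Subgraph.deleteVerts_adj]
      have h1 := hxS x hx
      have h2 := hxS y hy
      exact ⟨trivial, h1.2, trivial, h2.2, hxy⟩
    · have h1 : #S = #W + u.ncard := by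
        rw [hS, card_union_of_disjoint, card_map, Set.ncard_eq_toFinset_card']
        rw [Finset.disjoint_right]
        intro x hx
        simp only [mem_map] at hx
        obtain ⟨a, -, rfl⟩ := hx
        exact a.2
      -- The number of odd components has the parity of the order of `K`, hence of `|u|`, because
      -- `|Wᶜ|` is even. So the excess over `|u|` is at least 2.
      have h2 : K.oddComponents.ncard ≠ u.ncard + 1 := by
        intro h
        rw [h] at hparity
        rw [← hcard] at hW
        rw [Nat.even_add] at hW
        rw [Nat.odd_add_one, ← Nat.not_even_iff_odd] at hparity
        rw [← Nat.not_even_iff_odd] at hparity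
        tauto
      omega

/-! ### Assembling the factor from matchings -/

section Factor

variable {V : Type*}

theorem ncard_neighborSet_eq_degree (G : SimpleGraph V) (v : V) [Fintype (G.neighborSet v)] :
    (G.neighborSet v).ncard = G.degree v := by
  rw [Set.ncard_eq_toFinset_card', ← card_neighborFinset_eq_degree, neighborFinset]

theorem ncard_neighborSet_sup_of_le_sdiff [Finite V] {G F M : SimpleGraph V} (hM : M ≤ G \ F) (v : V) :
    ((F ⊔ M).neighborSet v).ncard = (F.neighborSet v).ncard + (M.neighborSet v).ncard := by
  rw [neighborSet_sup, Set.ncard_union_eq]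
  rw [Set.disjoint_right]
  intro w hw
  exact (hM hw).2

theorem hasFactor_of_ncard_neighborSet [Fintype V] {G H : SimpleGraph V} {k : ℕ} (hH : H ≤ G)
    (hreg : ∀ v, (H.neighborSet v).ncard = k) : G.HasFactor k := by
  refine ⟨H, hH, fun v => ?_⟩
  classical
  rw [← hreg v, ncard_neighborSet_eq_degree]

theorem ncard_neighborSet_edge [DecidableEq V] {u v : V} (huv : u ≠ v) (w : V) :
    ((edge u v).neighborSet w).ncard = if w = u ∨ w = v then 1 else 0 := by
  have h1 : (edge u v).neighborSet w =
      if w = u then {v} else if w = v then {u} else (∅ : Set V) := by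
    ext x
    rw [mem_neighborSet, edge_adj]
    split_ifs <;> simp <;> grind
  rw [h1]
  split_ifs <;> simp_all

variable [Fintype V] [DecidableEq V] {G : SimpleGraph V} [DecidableRel G.Adj] {m M : ℝ} {k : ℕ}

/-- Removing the edges of a graph `F` of maximum degree less than `k` and at most one vertex
leaves a graph with a perfect matching. -/
theorem LaplacianBounds.exists_matching (h : G.LaplacianBounds m M)
    (hm : 0 < m) (hM : k * M ≤ (k + 1) * m) (hk : 1 ≤ k) (hn : 2 * k ≤ Fintype.card V)
    (F : SimpleGraph V) (W : Finset V) (hW : Even #Wᶜ) (hW1 : #W ≤ 1) (hk1 : k = 1 → #W = 0)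
    (hF : ∀ v ∉ W, (F.neighborSet v).ncard < k) :
    ∃ N : SimpleGraph V, N ≤ G \ F ∧ (∀ v ∈ W, (N.neighborSet v).ncard = 0) ∧
      ∀ v ∉ W, (N.neighborSet v).ncard = 1 := by
  classical
  rcases exists_matching_or_exists_partition (G \ F) W hW with
    ⟨N, hN, hN0, hN1⟩ | ⟨S, ι, _, _, f, hWS, hf, hGF, hι⟩
  · refine ⟨N, hN, fun v hv => ?_, fun v hv => ?_⟩
    · rw [Set.ncard_eq_zero]
      ext w
      simpa using hN0 v hv w
    · rw [ncard_neighborSet_eq_degree, degree_eq_one_iff_existsUnique_adj]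
      exact hN1 v hv
  · exfalso
    have h1 := card_le_card hWS
    refine h.false_of_partition (F := F) (f := f) (S := S) hm hM hk hn ?_ hf ?_ (by omega)
      (by omega) (fun h => by have := hk1 h; omega)
    · intro x hx
      rw [← ncard_neighborSet_eq_degree]
      exact hF x fun h => hx (hWS h)
    · intro x hx y hy hxy hFxy
      exact hGF x hx y hy ⟨hxy, hFxy⟩

/-- If `F` contained every edge of `G`, the partition into singletons with `S = ∅` would be
forbidden by `false_of_partition`. -/
theorem LaplacianBounds.exists_adj_not_adj (h : G.LaplacianBounds m M)
    (hm : 0 < m) (hM : k * M ≤ (k + 1) * m) (hk : 2 ≤ k) (hn : 2 * k ≤ Fintype.card V)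
    (F : SimpleGraph V) (hF : ∀ v, (F.neighborSet v).ncard < k) :
    ∃ u v, G.Adj u v ∧ ¬ F.Adj u v := by
  classical
  by_contra! hcon
  refine h.false_of_partition (F := F) (f := id) (S := ∅) hm hM (by omega) hn ?_
    (fun i => ⟨i, by simp⟩) (fun x _ y _ hxy hFxy => absurd (hcon x y hxy) hFxy)
    (by simp; omega) (by omega) (by omega)
  intro x _
  rw [← ncard_neighborSet_eq_degree]
  exact hF x

theorem LaplacianBounds.exists_regular_of_even (h : G.LaplacianBounds m M)
    (hm : 0 < m) (hM : k * M ≤ (k + 1) * m) (hn : 2 * k ≤ Fintype.card V)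
    (heven : Even (Fintype.card V)) (j : ℕ) (hj : j ≤ k) :
    ∃ H ≤ G, ∀ v, (H.neighborSet v).ncard = j := by
  induction j with
  | zero => exact ⟨⊥, bot_le, fun v => by simp [neighborSet]⟩
  | succ j ih =>
    obtain ⟨H, hHG, hH⟩ := ih (by omega)
    obtain ⟨N, hN, -, hN1⟩ := h.exists_matching hm hM (by omega) hn H ∅ (by simpa using heven)
      (by simp) (by simp) (fun v _ => by rw [hH]; omega)
    refine ⟨H ⊔ N, sup_le hHG (hN.trans sdiff_le), fun v => ?_⟩
    rw [ncard_neighborSet_sup_of_le_sdiff hN, hH, hN1 v (by simp)]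

/-- Adding an edge `uv` and two matchings missing `u` and `v` respectively. -/
theorem LaplacianBounds.exists_regular_of_odd (h : G.LaplacianBounds m M)
    (hm : 0 < m) (hM : k * M ≤ (k + 1) * m) (hn : 2 * k ≤ Fintype.card V)
    (hodd : Odd (Fintype.card V)) (j : ℕ) (hj : 2 * j ≤ k) :
    ∃ H ≤ G, ∀ v, (H.neighborSet v).ncard = 2 * j := by
  induction j with
  | zero => exact ⟨⊥, bot_le, fun v => by simp [neighborSet]⟩
  | succ j ih =>
    obtain ⟨H, hHG, hH⟩ := ih (by omega)
    obtain ⟨u, v, huv, hHuv⟩ := h.exists_adj_not_adj hm hM (by omega) hn H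
      (fun v => by rw [hH]; omega)
    have hE : edge u v ≤ G \ H := by
      intro a b hab
      rw [edge_adj] at hab
      rcases hab.1 with ⟨rfl, rfl⟩ | ⟨rfl, rfl⟩
      · exact ⟨huv, hHuv⟩
      · exact ⟨huv.symm, fun h => hHuv h.symm⟩
    have hcard : ∀ w : V, Even #({w} : Finset V)ᶜ := by
      intro w
      rw [card_compl, card_singleton]
      exact Nat.Odd.sub_odd hodd odd_one
    have d1 : ∀ w, ((H ⊔ edge u v).neighborSet w).ncard =
        2 * j + if w = u ∨ w = v then 1 else 0 := by
      intro w
      rw [ncard_neighborSet_sup_of_le_sdiff hE, hH, ncard_neighborSet_edge huv.ne]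
    obtain ⟨N, hN, hN0, hN1⟩ := h.exists_matching hm hM (by omega) hn (H ⊔ edge u v) {u}
      (hcard u) (by simp) (by omega) (fun w _ => by rw [d1]; split_ifs <;> omega)
    have d2 : ∀ w, ((H ⊔ edge u v ⊔ N).neighborSet w).ncard =
        2 * j + (if w = u ∨ w = v then 1 else 0) + if w = u then 0 else 1 := by
      intro w
      rw [ncard_neighborSet_sup_of_le_sdiff hN, d1]
      split_ifs with h1 h2 <;> first | rw [hN0 w (by simpa)] | rw [hN1 w (by simpa)]
    -- At this stage `v` has degree `2j + 2`, possibly equal to `k`, and all other vertices have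
    -- degree `2j + 1`. The degree bound is only needed off `{v}`.
    obtain ⟨N', hN', hN0', hN1'⟩ := h.exists_matching hm hM (by omega) hn
      (H ⊔ edge u v ⊔ N) {v} (hcard v) (by simp) (by omega) (fun w hw => by
        rw [d2]
        have : w ≠ v := by simpa using hw
        split_ifs <;> first | omega | simp_all)
    refine ⟨H ⊔ edge u v ⊔ N ⊔ N', sup_le (sup_le (sup_le hHG (hE.trans sdiff_le))
      (hN.trans sdiff_le)) (hN'.trans sdiff_le), fun w => ?_⟩
    rw [ncard_neighborSet_sup_of_le_sdiff hN', d2]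
    by_cases hwv : w = v
    · subst hwv
      rw [hN0' w (by simp)]
      simp [huv.ne']
      omega
    · rw [hN1' w (by simpa)]
      by_cases hwu : w = u
      · simp [hwu]; omega
      · simp [hwu, hwv]; omega

theorem LaplacianBounds.exists_regular (h : G.LaplacianBounds m M)
    (hm : 0 < m) (hM : k * M ≤ (k + 1) * m) (hn : 2 * k ≤ Fintype.card V)
    (heven : Even (k * Fintype.card V)) :
    ∃ H ≤ G, ∀ v, (H.neighborSet v).ncard = k := by
  rcases Nat.even_or_odd (Fintype.card V) with hV | hV
  · exact h.exists_regular_of_even hm hM hn hV k le_rfl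
  · obtain ⟨j, hj⟩ : Even k := by
      rcases Nat.even_mul.mp heven with h | h
      · exact h
      · exact absurd h (Nat.not_even_iff_odd.mpr hV)
    rw [← two_mul] at hj
    obtain ⟨H, hHG, hH⟩ := h.exists_regular_of_odd hm hM hn hV j hj.ge
    exact ⟨H, hHG, fun v => by rw [hH, hj]⟩

theorem LaplacianBounds.hasFactor (h : G.LaplacianBounds m M)
    (hm : 0 < m) (hmM : m ≤ M) (hM : k * M ≤ (k + 1) * m) (hn : k + 1 ≤ Fintype.card V)
    (heven : Even (k * Fintype.card V)) : G.HasFactor k := by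
  rcases le_or_gt (2 * k) (Fintype.card V) with hk | hk
  · obtain ⟨H, hHG, hH⟩ := h.exists_regular hm hM hk heven
    exact hasFactor_of_ncard_neighborSet hHG hH
  · have htop := h.eq_top hm hM (by omega)
    -- `G` is complete and `l = n - 1 - k ≤ k`, so it suffices to find an `l`-regular graph and
    -- complement it. The eigenvalue condition passes from `k` to `l` because `m ≤ M`.
    obtain ⟨l, hl⟩ := Nat.exists_eq_add_of_le hn
    have hlk : (l : ℝ) ≤ k := by
      have : l ≤ k := by omega
      exact_mod_cast this
    have hMl : l * M ≤ (l + 1) * m := by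
      by_contra! hcon
      have h1 : (k - l) * m ≤ (k - l) * M := mul_le_mul_of_nonneg_left hmM (by linarith)
      linarith
    have hel : Even (l * Fintype.card V) := by
      rw [hl] at heven ⊢
      simp only [Nat.even_mul, Nat.even_add, Nat.not_even_one] at heven ⊢
      tauto
    obtain ⟨H, -, hH⟩ := h.exists_regular hm hMl (by omega) hel
    classical
    refine hasFactor_of_ncard_neighborSet (H := Hᶜ) (by rw [htop]; exact le_top) fun v => ?_
    rw [ncard_neighborSet_eq_degree, degree_compl, ← ncard_neighborSet_eq_degree, hH]
    omega

end Factor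

end SimpleGraph

end

theorem mainTheorem4 {V : Type*} [Fintype V] [DecidableEq V]
    (G : SimpleGraph V) [DecidableRel G.Adj] (hG : G.edgeSet.Nonempty)
    (k : ℕ) (hk : 1 ≤ k) (hn : k + 1 ≤ Fintype.card V) (heven : Even (k * Fintype.card V))
    (hμ : (k : ℝ) / ((k : ℝ) + 1) ≤
      G.laplacianEigenvalue 2 / G.laplacianEigenvalue (Fintype.card V)) :
    G.HasFactor k := by
  have hk' : (0 : ℝ) < k := by exact_mod_cast hk
  have hpos : 0 < G.laplacianEigenvalue 2 / G.laplacianEigenvalue (Fintype.card V) :=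
    lt_of_lt_of_le (by positivity) hμ
  have hM : 0 < G.laplacianEigenvalue (Fintype.card V) := by
    refine (G.laplacianEigenvalue_nonneg _).lt_of_ne fun h => ?_
    rw [← h, div_zero] at hpos
    exact hpos.false
  have hm : 0 < G.laplacianEigenvalue 2 := by
    refine (G.laplacianEigenvalue_nonneg _).lt_of_ne fun h => ?_
    rw [← h, zero_div] at hpos
    exact hpos.false
  have hV : 2 ≤ Fintype.card V := by omega
  have hmM : G.laplacianEigenvalue 2 ≤ G.laplacianEigenvalue (Fintype.card V) := by
    obtain ⟨i₀, hi₀⟩ := G.exists_forall_ne_laplacianEigenvalue_two_le hV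
    have : Nontrivial V := Fintype.one_lt_card_iff_nontrivial.mp hV
    obtain ⟨i, hi⟩ := exists_ne i₀
    exact (hi₀ i hi).trans (G.eigenvalues_le_laplacianEigenvalue_card i)
  rw [div_le_div_iff₀ (by positivity) hM] at hμ
  exact (G.laplacianBounds_laplacianEigenvalue hV hm).hasFactor hm hmM (by linarith) hn heven
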